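/- Let $n,s,k,r$ be integers with $s\ge 0$, $n\ge 2s+1$ and $k\ge r\ge 3$. All graphs are finite and simple; $K_m$ denotes the complete graph on $m$ vertices and $M_m$ the matching consisting of $m$ pairwise disjoint edges. For graphs $G$ and $T$, let $N(G,T)$ be the number of subgraphs of $G$ (not necessarily induced) that are isomorphic to $T$. For a set $\mathcal H$ of graphs, a graph is $\mathcal H$-free if it contains no member of $\mathcal H$ as a (not necessarily induced) subgraph, and $$\mathrm{ex}(n,T,\mathcal H)=\max\{N(G,T) : G \text{ is an } n\text{-vertex } \mathcal H\text{-free graph}\}.$$ Let $T_k(m)$ be the Turán graph, i.e. the complete $k$-partite graph on $m$ vertices whose parts have sizes as equal as possible (parts may be empty when $m<k$), and let $G_k(n,s)=\overline{K_{n-s}}\vee T_{k-1}(s)$ be the join of the empty graph on $n-s$ vertices and the Turán graph $T_{k-1}(s)$. Then $$\mathrm{ex}(n,K_r,\{K_{k+1},M_{s+1}\})=\max\{N(T_k(2s+1),K_r),\,N(G_k(n,s),K_r)\}.$$ -/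

import Mathlib

/-- The matching `M_s` with `s` edges: the disjoint edges `{2i, 2i+1}`, `i < s`. -/
def matchingGraph (s : ℕ) : SimpleGraph (Fin (2 * s)) where
  Adj v w := v ≠ w ∧ v.val / 2 = w.val / 2
  symm := ⟨fun _ _ h => ⟨h.1.symm, h.2.symm⟩⟩
  loopless := ⟨fun _ h => h.1 rfl⟩

/-- The join `G ∨ H`: the disjoint union of `G` and `H` together with all edges between them. -/
def graphJoin {V W : Type*} (G : SimpleGraph V) (H : SimpleGraph W) : SimpleGraph (V ⊕ W) :=
  (G ⊕g H) ⊔ completeBipartiteGraph V W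

/-- `G_k(n,s)`: the join of the empty graph on `n - s` vertices and the Turán graph `T_{k-1}(s)`
(`turanGraph s (k - 1)` has `s` vertices and `k - 1` parts). Meant for `s ≤ n` and `2 ≤ k`. -/
def alonFranklGraph (k n s : ℕ) : SimpleGraph (Fin (n - s) ⊕ Fin s) :=
  graphJoin (⊥ : SimpleGraph (Fin (n - s))) (SimpleGraph.turanGraph s (k - 1))

/-- A family of finite graphs. -/
abbrev GraphFamily : Type := Set (Σ m : ℕ, SimpleGraph (Fin m))

/-- `G` is `𝓗`-free: `G` contains no copy of any member of `𝓗` as a (not necessarily induced)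
subgraph. -/
def FamilyFree {V : Type*} (𝓗 : GraphFamily) (G : SimpleGraph V) : Prop :=
  ∀ H ∈ 𝓗, H.2.Free G

/-- `ex(n, T, 𝓗) = N`: the maximum of the number of copies of `T` in `G`, over all `𝓗`-free graphs
`G` on `n` vertices, exists and is equal to `N`. -/
def IsGeneralizedTuranNumber (n : ℕ) {W : Type*} (T : SimpleGraph W) (𝓗 : GraphFamily)
    (N : ℕ) : Prop :=
  IsGreatest {c : ℕ | ∃ G : SimpleGraph (Fin n), FamilyFree 𝓗 G ∧ c = G.copyCount T} N

/-! Both candidates are admissible: neither `2s + 1` non-isolated vertices nor a vertex cover of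
size `s` leaves room for `s + 1` disjoint edges.

For the upper bound, the Tutte–Berge formula gives a set `B` of `b` vertices such that `G - B` has
at least `n + b - 2s` components; hence `b ≤ s`. Fix `y` outside `B` lying in the most `r`-cliques,
take a transversal `I` of `n + b - (2s + 1)` components avoiding that of `y`, and turn every other
vertex outside `B` and outside the component of `y` into a twin of `y` (`cliqueCountOn_le_comap`).
No `r`-cliques are lost in number, no `K_{k+1}` appears, `I` becomes independent with all its
neighbours in `B`, and `2s + 1 - b` vertices lie outside `I`.

Let `S ⊆ B` be the neighbourhood of a vertex of `I` in the most `r`-cliques. It is `K_k`-free, so a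
refinement of Zykov's theorem (`exists_cliqueCountOn_le_joinCliqueCount`) bounds the cliques outside
`I` by those of an empty graph joined to `T_{k-1}(u)` with `u ≥ |S|`, while each vertex of `I` lies
in at most `N(T_{k-1}(min(u,b)), K_{r-1})` cliques. The rest is numerical
(`joinCliqueCount_add_mul_le`): if `b ≤ u`, then for fixed `u + b` the bound is convex in `b`, and
its end values are dominated by the two extremal counts; if `u ≤ b`, monotonicity in `u` suffices.
-/

/-! ### Clique counts of Turán graphs -/

/-- The number of `r`-cliques of the Turán graph on `m` vertices with `k` parts, computed by adding
the vertices one at a time. -/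
def turanCliqueCount : ℕ → ℕ → ℕ → ℕ
  | _, 0, _ => 1
  | 0, _ + 1, _ => 0
  | _ + 1, _ + 1, 0 => 0
  | k + 1, r + 1, m + 1 =>
    turanCliqueCount (k + 1) (r + 1) m + turanCliqueCount k r (m - m / (k + 1))

namespace turanCliqueCount

@[simp] lemma zero_right (k m : ℕ) : turanCliqueCount k 0 m = 1 := by
  simp [turanCliqueCount]

@[simp] lemma zero_left (r m : ℕ) : turanCliqueCount 0 (r + 1) m = 0 := by
  simp [turanCliqueCount]

@[simp] lemma zero_vertices (k r : ℕ) : turanCliqueCount k (r + 1) 0 = 0 := by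
  cases k <;> simp [turanCliqueCount]

lemma succ (k r m : ℕ) : turanCliqueCount (k + 1) (r + 1) (m + 1) =
    turanCliqueCount (k + 1) (r + 1) m + turanCliqueCount k r (m - m / (k + 1)) := by
  rw [turanCliqueCount]

lemma mono (k r : ℕ) : Monotone (turanCliqueCount k r) := by
  refine monotone_nat_of_le_succ fun m => ?_
  rcases k with _ | k <;> rcases r with _ | r
  · simp
  · simp
  · simp
  · rw [succ]; omega

lemma sub_div_mono (k : ℕ) : Monotone fun m : ℕ => m - m / (k + 1) := by
  refine monotone_nat_of_le_succ fun m => ?_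
  have : (m + 1) / (k + 1) ≤ m / (k + 1) + 1 := by
    rw [Nat.succ_div]; split_ifs <;> omega
  have := Nat.div_le_self m (k + 1)
  omega

/-- Removing a smallest part from a Turán graph. -/
lemma eq_add_mul (k r m : ℕ) : turanCliqueCount (k + 1) (r + 1) m =
    turanCliqueCount k (r + 1) (m - m / (k + 1)) +
      m / (k + 1) * turanCliqueCount k r (m - m / (k + 1)) := by
  induction k generalizing r m with
  | zero =>
    induction m with
    | zero => simp
    | succ m ih => rw [succ, ih]; simp [Nat.add_mul]
  | succ k ihk =>
    induction m with
    | zero => simp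
    | succ m ih =>
      rw [succ, ih]
      have hq := Nat.div_add_mod m (k + 1 + 1)
      have hlt := Nat.mod_lt m (show k + 1 + 1 > 0 by omega)
      set q := m / (k + 1 + 1) with hqdef
      set ρ := m % (k + 1 + 1) with hρ
      have hmq : m - q = q * (k + 1) + ρ := by
        rw [← hq]; apply Nat.sub_eq_of_eq_add; ring
      -- If `ρ = k + 1`, only one part has size `q`; the new vertex enlarges it and the other parts
      -- are unchanged. Otherwise the new vertex can go to another part of size `q`.
      by_cases h : ρ = k + 1
      · have h1 : (m + 1) / (k + 1 + 1) = q + 1 := by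
          rw [← hq, h, show (k + 1 + 1) * q + (k + 1) + 1 = (k + 1 + 1) * (q + 1) by ring]
          exact Nat.mul_div_cancel_left _ (by omega)
        rw [h1, show m + 1 - (q + 1) = m - q by omega]
        ring
      · have h1 : (m + 1) / (k + 1 + 1) = q := by
          rw [← hq, show (k + 1 + 1) * q + ρ + 1 = (ρ + 1) + (k + 1 + 1) * q by ring,
            Nat.add_mul_div_left _ _ (by omega), Nat.div_eq_of_lt (by omega), zero_add]
        have h2 : (m - q) / (k + 1) = q := by
          rw [hmq, show q * (k + 1) + ρ = ρ + (k + 1) * q by ring,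
            Nat.add_mul_div_left _ _ (by omega), Nat.div_eq_of_lt (by omega), zero_add]
        have h3 : m + 1 - q = (m - q) + 1 := by
          have : q ≤ m := Nat.div_le_self _ _
          omega
        rw [h1, h3, succ, h2]
        rcases r with _ | r
        · simp; ring
        · rw [succ, ihk r (m - q), h2]; ring

lemma mono_left (r m : ℕ) : Monotone fun k => turanCliqueCount k r m := by
  have key : ∀ k r m, turanCliqueCount k r m ≤ turanCliqueCount (k + 1) r m := by
    intro k
    induction k with
    | zero =>
      intro r m
      rcases r with _ | r <;> simp
    | succ k ih =>
      intro r m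
      rcases r with _ | r
      · simp
      induction m with
      | zero => simp
      | succ m ihm =>
        rw [succ, succ]
        refine Nat.add_le_add ihm ((ih _ _).trans (mono _ _ ?_))
        have : m / (k + 1 + 1) ≤ m / (k + 1) := Nat.div_le_div_left (by omega) (by omega)
        omega
  exact monotone_nat_of_le_succ fun k => key k r m

/-- The increments are clique counts of Turán graphs with one part fewer, on `m - m / (k + 1)`
vertices, and these grow with `m`. -/
lemma convex (k r m : ℕ) : 2 * turanCliqueCount k r (m + 1) ≤
    turanCliqueCount k r m + turanCliqueCount k r (m + 2) := by
  rcases k with _ | k <;> rcases r with _ | r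
  · simp
  · simp
  · simp
  · rw [succ k r (m + 1), succ k r m]
    have := mono k r (sub_div_mono k (Nat.le_succ m))
    dsimp only [Nat.succ_eq_add_one] at this
    omega

end turanCliqueCount

/-! ### Clique counts of joins and the numerical optimisation -/

/-- The number of `(r + 1)`-cliques of the join of an empty graph on `n - σ` vertices and the Turán
graph on `σ` vertices with `k` parts. -/
def joinCliqueCount (k r n σ : ℕ) : ℕ :=
  turanCliqueCount k (r + 1) σ + (n - σ) * turanCliqueCount k r σ

namespace joinCliqueCount

open turanCliqueCount

/-- Moving a vertex from the empty side into a smallest part, of size `q = σ / (k + 1)`, destroys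
only the cliques using it and one of those `q` vertices. It gains equally many with each of the `n -
σ - 1 ≥ σ ≥ q` vertices left on the empty side. -/
lemma le_succ {k r n σ : ℕ} (h : 2 * σ + 1 ≤ n) :
    joinCliqueCount (k + 1) (r + 1) n σ ≤ joinCliqueCount (k + 1) (r + 1) n (σ + 1) := by
  unfold joinCliqueCount
  have e := eq_add_mul k r σ
  have hq : σ / (k + 1) ≤ σ := Nat.div_le_self _ _
  obtain ⟨t, rfl⟩ : ∃ t, n = 2 * σ + 1 + t := ⟨_, (Nat.add_sub_cancel' h).symm⟩
  rw [show 2 * σ + 1 + t - σ = σ + t + 1 by omega, show 2 * σ + 1 + t - (σ + 1) = σ + t by omega,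
    succ k (r + 1) σ, succ k r σ]
  have : σ / (k + 1) * turanCliqueCount k r (σ - σ / (k + 1)) ≤
      (σ + t) * turanCliqueCount k r (σ - σ / (k + 1)) := Nat.mul_le_mul_right _ (by omega)
  rw [Nat.add_mul (σ + t) 1, one_mul, Nat.mul_add]
  omega

lemma le_of_le {k r n s u : ℕ} (hn : 2 * s + 1 ≤ n) (hu : u ≤ s) :
    joinCliqueCount (k + 1) (r + 1) n u ≤ joinCliqueCount (k + 1) (r + 1) n s := by
  induction s, hu using Nat.le_induction with
  | base => exact le_rfl
  | succ s _ ih => exact (ih (by omega)).trans (le_succ (by omega))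

end joinCliqueCount

/-- A convex sequence on an initial segment is bounded by its values at the end points. -/
lemma le_max_of_convex {h : ℕ → ℕ} {N : ℕ}
    (hc : ∀ b, b + 2 ≤ N → 2 * h (b + 1) ≤ h b + h (b + 2)) {b : ℕ} (hb : b ≤ N) :
    h b ≤ max (h 0) (h N) := by
  by_cases hex : ∃ a, a < b ∧ h a < h (a + 1)
  · obtain ⟨a, hab, ha⟩ := hex
    have inc : ∀ j, a + j + 1 ≤ N → h (a + j) < h (a + j + 1) := by
      intro j
      induction j with
      | zero => intro _; exact ha
      | succ j ih =>
        intro hj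
        have h1 := ih (by omega)
        have h2 := hc (a + j) (by omega)
        rw [show a + (j + 1) + 1 = a + j + 2 by omega, show a + (j + 1) = a + j + 1 by omega]
        omega
    have up : ∀ j, b + j ≤ N → h b ≤ h (b + j) := by
      intro j
      induction j with
      | zero => intro _; exact le_rfl
      | succ j ih =>
        intro hj
        have h1 := ih (by omega)
        have h2 := inc (b + j - a) (by omega)
        rw [show a + (b + j - a) = b + j by omega] at h2
        rw [show b + (j + 1) = b + j + 1 by omega]
        omega
    have := up (N - b) (by omega)
    rw [show b + (N - b) = N by omega] at this
    exact this.trans (le_max_right _ _)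
  · push Not at hex
    have down : ∀ j, j ≤ b → h j ≤ h 0 := by
      intro j
      induction j with
      | zero => intro _; exact le_rfl
      | succ j ih => intro hj; exact (hex j (by omega)).trans (ih (by omega))
    exact (down b le_rfl).trans (le_max_left _ _)

open turanCliqueCount in
/-- The numerical optimisation: interpolating between `T_k(2s+1)` and `G_k(n,s)`. -/
lemma joinCliqueCount_add_mul_le {k r n s b u : ℕ} (hn : 2 * s + 1 ≤ n) (hb : b ≤ s)
    (hu : u ≤ 2 * s + 1 - b)
    (hT : ∀ u ≤ 2 * s + 1, joinCliqueCount (k + 1) (r + 1) (2 * s + 1) u ≤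
      turanCliqueCount (k + 2) (r + 2) (2 * s + 1)) :
    joinCliqueCount (k + 1) (r + 1) (2 * s + 1 - b) u +
        (n - (2 * s + 1 - b)) * turanCliqueCount (k + 1) (r + 1) (min u b) ≤
      max (turanCliqueCount (k + 2) (r + 2) (2 * s + 1))
        (joinCliqueCount (k + 1) (r + 1) n s) := by
  rcases le_total u b with hub | hbu
  · refine le_max_of_le_right (le_trans ?_ (joinCliqueCount.le_of_le hn (hub.trans hb)))
    rw [min_eq_left hub]
    unfold joinCliqueCount
    rw [add_assoc, ← Nat.add_mul]
    gcongr
    omega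
  rw [min_eq_right hbu]
  obtain ⟨e, rfl⟩ : ∃ e, n = 2 * s + 1 + e := ⟨_, (Nat.add_sub_cancel' hn).symm⟩
  -- With `L` fixed, `x` varies in place of `b` and `L - x` in place of `u`. Then `h 0` counts a
  -- join on `2s + 1` vertices, and `h (L / 2)` is compared with joins on `n` vertices.
  set L := u + b with hL
  set c := 2 * s + 1 - L with hc
  let h : ℕ → ℕ := fun x => turanCliqueCount (k + 1) (r + 2) (L - x) +
    c * turanCliqueCount (k + 1) (r + 1) (L - x) + (e + x) * turanCliqueCount (k + 1) (r + 1) x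
  have conv : ∀ x, x + 2 ≤ L / 2 → 2 * h (x + 1) ≤ h x + h (x + 2) := by
    intro x hx
    obtain ⟨y, hy⟩ : ∃ y, L = y + x + 2 := ⟨L - x - 2, by omega⟩
    have e0 : L - x = y + 2 := by omega
    have e1 : L - (x + 1) = y + 1 := by omega
    have e2 : L - (x + 2) = y := by omega
    simp only [h, e0, e1, e2]
    have c1 := convex (k + 1) (r + 2) y
    have c2 := Nat.mul_le_mul_left c (convex (k + 1) (r + 1) y)
    have c3 := Nat.mul_le_mul_left (e + x + 1) (convex (k + 1) (r + 1) x)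
    have c4 := mono (k + 1) (r + 1) (show x ≤ x + 2 by omega)
    nlinarith
  have hLs : L ≤ 2 * s + 1 := by omega
  have main := le_max_of_convex (b := b) conv (by omega)
  have e1 : joinCliqueCount (k + 1) (r + 1) (2 * s + 1 - b) u +
      (2 * s + 1 + e - (2 * s + 1 - b)) * turanCliqueCount (k + 1) (r + 1) b = h b := by
    simp only [h, joinCliqueCount]
    rw [show L - b = u by omega, show 2 * s + 1 - b - u = c by omega,
      show 2 * s + 1 + e - (2 * s + 1 - b) = e + b by omega]
  rw [e1]
  refine main.trans (max_le_max ?_ ?_)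
  · have := hT L hLs
    simpa [h, joinCliqueCount] using this
  · rcases Nat.even_or_odd' L with ⟨t, ht | ht⟩
    · have hLt : L / 2 = t := by omega
      refine le_trans ?_ (joinCliqueCount.le_of_le hn (show t ≤ s by omega))
      simp only [h, hLt, joinCliqueCount]
      rw [show L - t = t by omega, add_assoc, ← Nat.add_mul]
      gcongr
      omega
    · have hLt : L / 2 = t := by omega
      simp only [h, hLt]
      rw [show L - t = t + 1 by omega]
      -- The natural comparison is with Turán side `t + 1`, which exceeds `s` when `t = s`. There
      -- the side `t` serves instead: the surplus Turán vertex lies in no more cliques than a vertex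
      -- of the empty side.
      rcases (show t ≤ s by omega).eq_or_lt with rfl | hts
      · rw [show c = 0 by omega]
        unfold joinCliqueCount
        rw [succ, show 2 * t + 1 + e - t = (e + t) + 1 by omega, Nat.add_mul _ 1, one_mul]
        have h1 : turanCliqueCount k (r + 1) (t - t / (k + 1)) ≤
            turanCliqueCount (k + 1) (r + 1) (t - t / (k + 1)) := mono_left _ _ (Nat.le_succ k)
        have h2 := mono (k + 1) (r + 1) (Nat.sub_le t (t / (k + 1)))
        omega
      · refine le_trans ?_ (joinCliqueCount.le_of_le hn (show t + 1 ≤ s by omega))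
        unfold joinCliqueCount
        have h2 := Nat.mul_le_mul_left (e + t) (mono (k + 1) (r + 1) (show t ≤ t + 1 by omega))
        rw [show 2 * s + 1 + e - (t + 1) = c + (e + t) by omega, Nat.add_mul c,
          show r + 1 + 1 = r + 2 from rfl]
        omega

/-! ### Cliques inside a finite set; Zykov's theorem and a refinement -/

open Classical in
/-- The number of `r`-cliques of `G` contained in `A`. -/
noncomputable def cliqueCountOn {V : Type*} (G : SimpleGraph V) (r : ℕ) (A : Finset V) : ℕ :=
  ((A.powersetCard r).filter fun t : Finset V => G.IsClique (t : Set V)).card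

section cliqueCountOn

open Classical Finset

variable {V : Type*} {G : SimpleGraph V}

lemma mem_filter_isClique {r : ℕ} {A t : Finset V} :
    t ∈ (A.powersetCard r).filter (fun t : Finset V => G.IsClique (t : Set V)) ↔
      t ⊆ A ∧ t.card = r ∧ G.IsClique t := by
  simp [mem_powersetCard, and_assoc]

lemma cliqueCountOn_mono (r : ℕ) {A B : Finset V} (h : A ⊆ B) :
    cliqueCountOn G r A ≤ cliqueCountOn G r B :=
  card_le_card (filter_subset_filter _ (powersetCard_mono h))

@[simp] lemma cliqueCountOn_zero (A : Finset V) : cliqueCountOn G 0 A = 1 := by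
  simp [cliqueCountOn, filter_singleton]

@[simp] lemma cliqueCountOn_empty (r : ℕ) : cliqueCountOn G (r + 1) (∅ : Finset V) = 0 := by
  have : powersetCard (r + 1) (∅ : Finset V) = ∅ := powersetCard_eq_empty.2 (by simp)
  simp [cliqueCountOn, this]

lemma cliqueCountOn_insert (r : ℕ) {A : Finset V} {v : V} (hv : v ∉ A) :
    cliqueCountOn G (r + 1) (insert v A) =
      cliqueCountOn G (r + 1) A + cliqueCountOn G r (A.filter (G.Adj v)) := by
  unfold cliqueCountOn
  rw [powersetCard_succ_insert hv, filter_union, card_union_of_disjoint]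
  · congr 1
    symm
    refine card_bij (fun t _ => insert v t) ?_ ?_ ?_
    · intro t ht
      obtain ⟨h1, h2, h3⟩ := mem_filter_isClique.1 ht
      refine mem_filter.2 ⟨mem_image.2 ⟨t, mem_powersetCard.2 ⟨h1.trans (filter_subset _ _), h2⟩,
        rfl⟩, ?_⟩
      rw [coe_insert]
      exact h3.insert fun b hb _ => (mem_filter.1 (h1 hb)).2
    · intro s hs t ht hst
      have hs' : v ∉ s := fun h => hv (mem_filter.1 ((mem_filter_isClique.1 hs).1 h)).1
      have ht' : v ∉ t := fun h => hv (mem_filter.1 ((mem_filter_isClique.1 ht).1 h)).1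
      rw [← erase_insert hs', hst, erase_insert ht']
    · intro s hs
      obtain ⟨h1, h2⟩ := mem_filter.1 hs
      obtain ⟨t, ht, rfl⟩ := mem_image.1 h1
      obtain ⟨h3, h4⟩ := mem_powersetCard.1 ht
      refine ⟨t, mem_filter_isClique.2 ⟨fun x hx => mem_filter.2 ⟨h3 hx, ?_⟩, h4,
        h2.subset (by simp)⟩, rfl⟩
      exact h2 (by simp) (by simp [hx]) (by rintro rfl; exact hv (h3 hx))
  · refine disjoint_filter_filter (disjoint_left.2 fun t ht ht' => ?_)
    obtain ⟨s, _, rfl⟩ := mem_image.1 ht'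
    exact hv ((mem_powersetCard.1 ht).1 (mem_insert_self _ _))

lemma cliqueCountOn_insert_le (r : ℕ) (A : Finset V) (v : V) :
    cliqueCountOn G (r + 1) (insert v A) ≤
      cliqueCountOn G (r + 1) A + cliqueCountOn G r (A.filter (G.Adj v)) := by
  by_cases hv : v ∈ A
  · rw [insert_eq_of_mem hv]; omega
  · exact (cliqueCountOn_insert r hv).le

lemma cliqueCountOn_union_le (r : ℕ) (A X : Finset V) :
    cliqueCountOn G (r + 1) (A ∪ X) ≤ cliqueCountOn G (r + 1) A +
      ∑ x ∈ X, cliqueCountOn G r ((A ∪ X).filter (G.Adj x)) := by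
  induction X using Finset.induction_on with
  | empty => simp
  | insert x X hx ih =>
    rw [sum_insert hx, union_insert]
    refine (cliqueCountOn_insert_le r _ x).trans ?_
    have h1 : cliqueCountOn G r ((A ∪ X).filter (G.Adj x)) ≤
        cliqueCountOn G r ((insert x (A ∪ X)).filter (G.Adj x)) :=
      cliqueCountOn_mono r (filter_subset_filter _ (subset_insert _ _))
    have h2 : ∑ y ∈ X, cliqueCountOn G r ((A ∪ X).filter (G.Adj y)) ≤
        ∑ y ∈ X, cliqueCountOn G r ((insert x (A ∪ X)).filter (G.Adj y)) :=
      sum_le_sum fun y _ => cliqueCountOn_mono r (filter_subset_filter _ (subset_insert _ _))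
    omega

/-- The left side counts exactly the cliques with at most one vertex in `X`. -/
lemma le_cliqueCountOn_union (r : ℕ) {A X : Finset V} (h : Disjoint A X) :
    cliqueCountOn G (r + 1) A + ∑ x ∈ X, cliqueCountOn G r (A.filter (G.Adj x)) ≤
      cliqueCountOn G (r + 1) (A ∪ X) := by
  induction X using Finset.induction_on with
  | empty => simp
  | insert x X hx ih =>
    rw [disjoint_insert_right] at h
    rw [sum_insert hx, union_insert, cliqueCountOn_insert r (by simp [h.1, hx])]
    have h1 : cliqueCountOn G r (A.filter (G.Adj x)) ≤
        cliqueCountOn G r ((A ∪ X).filter (G.Adj x)) :=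
      cliqueCountOn_mono r (filter_subset_filter _ subset_union_left)
    have := ih h.2
    omega

lemma cliqueFreeOn_filter_adj {k : ℕ} {A : Finset V} {v : V}
    (h : G.CliqueFreeOn (insert v A : Finset V) (k + 1)) :
    G.CliqueFreeOn (A.filter (G.Adj v) : Finset V) k := by
  refine SimpleGraph.CliqueFreeOn.subset _ ?_
    (SimpleGraph.CliqueFreeOn.of_succ _ h (a := v) (by simp))
  intro x hx
  have := mem_filter.1 (mem_coe.1 hx)
  exact ⟨by simp [this.1], this.2⟩

/-- Greedy choice: each chosen vertex excludes at most `q` candidates, itself included, so `k + 1`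
choices are possible. -/
lemma exists_clique_of_card_nonadj_le {k q : ℕ} {S : Finset V}
    (hq : ∀ x ∈ S, (S.filter fun y => ¬ G.Adj x y).card ≤ q) (hS : q * k < S.card) :
    ¬ G.CliqueFreeOn (S : Set V) (k + 1) := by
  induction k generalizing S with
  | zero =>
    intro h
    obtain ⟨x, hx⟩ := card_pos.1 (by omega : 0 < S.card)
    exact h (t := {x}) (by simpa using hx) ⟨by simp, by simp⟩
  | succ k ih =>
    intro h
    obtain ⟨x, hx⟩ := card_pos.1 (by omega : 0 < S.card)
    refine ih (S := S.filter (G.Adj x)) ?_ ?_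
      (cliqueFreeOn_filter_adj (by rwa [insert_eq_of_mem hx]))
    · intro y hy
      exact (card_le_card (filter_subset_filter _ (filter_subset _ _))).trans
        (hq y (mem_filter.1 hy).1)
    · have h1 := card_filter_add_card_filter_not (s := S) (G.Adj x)
      have h2 := hq x hx
      rw [Nat.mul_succ] at hS
      omega

/-- Otherwise every vertex has at most `m / k` non-neighbours, itself included, and the greedy
choice finds a `K_{k+1}`. The bound is the one in the recursion of `turanCliqueCount`. -/
lemma exists_card_filter_adj_le {k m : ℕ} {S : Finset V} (hS : S.card = m + 1)
    (hfree : G.CliqueFreeOn (S : Set V) (k + 1)) :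
    ∃ x ∈ S, (S.filter (G.Adj x)).card ≤ m - m / k := by
  by_contra! h
  refine exists_clique_of_card_nonadj_le (q := m / k) (fun x hx => ?_) ?_ hfree
  · have h1 := card_filter_add_card_filter_not (s := S) (G.Adj x)
    have := h x hx
    omega
  · have := Nat.div_mul_le_self m k
    omega

/-- **Zykov's theorem**: the Turán graph maximises the number of `r`-cliques. -/
theorem cliqueCountOn_le_turanCliqueCount (k r : ℕ) {A : Finset V}
    (h : G.CliqueFreeOn (A : Set V) (k + 1)) :
    cliqueCountOn G r A ≤ turanCliqueCount k r A.card := by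
  induction k generalizing r A with
  | zero =>
    have : A = ∅ := by
      by_contra hA
      obtain ⟨x, hx⟩ := nonempty_iff_ne_empty.2 hA
      exact h (t := {x}) (by simpa using hx) ⟨by simp, by simp⟩
    subst this
    cases r <;> simp
  | succ k ihk =>
    rcases r with _ | r
    · simp
    obtain ⟨m, hm⟩ : ∃ m, A.card = m := ⟨_, rfl⟩
    induction m generalizing A with
    | zero => simp [card_eq_zero.1 hm]
    | succ m ihm =>
      -- Cliques avoiding `x` are bounded by induction on `|A|`, those through `x` by induction on
      -- `k` inside its neighbourhood.
      obtain ⟨x, hx, hdeg⟩ := exists_card_filter_adj_le hm h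
      have hins := insert_erase hx
      have hc : (A.erase x).card = m := by rw [card_erase_of_mem hx, hm]; rfl
      have h1 := ihm (A := A.erase x) (SimpleGraph.CliqueFreeOn.subset _ (by simp) h) hc
      have h2 := ihk r (A := (A.erase x).filter (G.Adj x))
        (cliqueFreeOn_filter_adj (by rwa [hins]))
      have h3 := turanCliqueCount.mono k r
        ((card_le_card (filter_subset_filter (G.Adj x) (erase_subset x A))).trans hdeg)
      rw [hm, turanCliqueCount.succ]
      conv_lhs => rw [← hins]
      rw [cliqueCountOn_insert r (notMem_erase x A)]
      rw [hc] at h1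
      omega

/-- A clique bound for a `K_{k+2}`-free graph in which a small set `D` meets all `K_{k+1}`. -/
theorem cliqueCountOn_union_le_of_cliqueFreeOn (k r : ℕ) {S D : Finset V} {σ d : ℕ}
    (hσ : k * d ≤ σ) (hS : S.card ≤ σ) (hD : D.card ≤ d)
    (hSfree : G.CliqueFreeOn (S : Set V) (k + 1))
    (hfree : G.CliqueFreeOn ((S ∪ D : Finset V) : Set V) (k + 2)) :
    cliqueCountOn G (r + 1) (S ∪ D) ≤
      turanCliqueCount k (r + 1) σ + d * turanCliqueCount k r σ := by
  induction k using Nat.strong_induction_on generalizing r S D σ with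
  | _ k ihk =>
  induction σ, hσ using Nat.le_induction generalizing S with
  | base =>
    -- At `σ = k * d` this is Zykov's bound, since `T_{k+1}((k+1)d)` is `T_k(kd)` joined to `d`
    -- independent vertices.
    refine (cliqueCountOn_le_turanCliqueCount (k + 1) (r + 1) hfree).trans ?_
    have hc : (S ∪ D).card ≤ (k + 1) * d := by
      have := card_union_le S D
      rw [Nat.add_mul]; omega
    refine (turanCliqueCount.mono _ _ hc).trans ?_
    rw [turanCliqueCount.eq_add_mul, Nat.mul_div_cancel_left _ (Nat.succ_pos k),
      show (k + 1) * d - d = k * d by rw [Nat.add_mul]; omega]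
  | succ σ hσ ihσ =>
    rcases hS.lt_or_eq with hlt | heq
    · refine (ihσ (by omega) hSfree hfree).trans ?_
      gcongr <;> exact turanCliqueCount.mono _ _ (Nat.le_succ σ)
    obtain ⟨x, hx, hdeg⟩ := exists_card_filter_adj_le heq hSfree
    rcases k with _ | k
    · exact (hSfree (t := {x}) (by simpa using hx) ⟨by simp, by simp⟩).elim
    have hSx : ((S.erase x : Finset V) : Set V) ⊆ S := by simp
    have hins : insert x (S.erase x ∪ D) = S ∪ D := by rw [← insert_union, insert_erase hx]
    have hsub : ((S.erase x ∪ D : Finset V) : Set V) ⊆ (S ∪ D : Finset V) := by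
      rw [← hins]; simp
    have h1 := ihσ (S := S.erase x) (by rw [card_erase_of_mem hx]; omega)
      (SimpleGraph.CliqueFreeOn.subset _ hSx hSfree)
      (SimpleGraph.CliqueFreeOn.subset _ hsub hfree)
    have hle := cliqueCountOn_insert_le (G := G) r (S.erase x ∪ D) x
    rw [hins] at hle
    refine hle.trans ?_
    rcases r with _ | r
    · simp only [cliqueCountOn_zero, turanCliqueCount.zero_right, turanCliqueCount.succ] at h1 ⊢
      omega
    have hcard : ((S.erase x).filter (G.Adj x)).card ≤ σ - σ / (k + 1) :=
      (card_le_card (filter_subset_filter (G.Adj x) (erase_subset x S))).trans hdeg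
    -- The size condition is inherited by the neighbourhood of `x`, since `σ - σ / (k + 1)` is at
    -- least the fraction `k / (k + 1)` of `σ ≥ (k + 1) * d`.
    have hkd : k * d ≤ σ - σ / (k + 1) := by
      have h3 : (k + 1) * (k * d) ≤ (k + 1) * (σ - σ / (k + 1)) := by
        have h4 : (k + 1) * (σ / (k + 1)) ≤ σ := Nat.mul_div_le _ _
        rw [Nat.mul_sub, mul_left_comm]
        have h5 : k * ((k + 1) * d) ≤ k * σ := Nat.mul_le_mul_left _ hσ
        have h6 : (k + 1) * σ = k * σ + σ := by ring
        omega
      exact Nat.le_of_mul_le_mul_left h3 (Nat.succ_pos k)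
    have h2 := ihk k (Nat.lt_succ_self k) r (S := (S.erase x).filter (G.Adj x))
      (D := D.filter (G.Adj x)) hkd hcard ((card_filter_le _ _).trans hD)
      (cliqueFreeOn_filter_adj (by rwa [insert_erase hx]))
      (by rw [← filter_union]; exact cliqueFreeOn_filter_adj (by rwa [hins]))
    rw [← filter_union] at h2
    rw [turanCliqueCount.succ k (r + 1), turanCliqueCount.succ k r, Nat.mul_add]
    omega

/-- In a `K_{k+2}`-free graph, a `K_{k+1}`-free set `S` lets the number of cliques be bounded by that
of a join in which the Turán graph has at least `|S|` vertices. -/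
theorem exists_cliqueCountOn_le_joinCliqueCount (k r : ℕ) {S M : Finset V} (hSM : S ⊆ M)
    (hSfree : G.CliqueFreeOn (S : Set V) (k + 1))
    (hfree : G.CliqueFreeOn (M : Set V) (k + 2)) :
    ∃ u, S.card ≤ u ∧ u ≤ M.card ∧
      cliqueCountOn G (r + 1) M ≤ joinCliqueCount k r M.card u := by
  have hcM := card_le_card hSM
  have hcD := card_sdiff_of_subset hSM
  by_cases h : k * (M.card - S.card) ≤ S.card
  · refine ⟨S.card, le_rfl, hcM, ?_⟩
    have := cliqueCountOn_union_le_of_cliqueFreeOn k r (D := M \ S) h le_rfl hcD.le hSfree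
      (by rwa [union_sdiff_of_subset hSM])
    rwa [union_sdiff_of_subset hSM] at this
  -- When `S` is this small, Zykov's bound for all of `M` suffices: the Turán graph is a join whose
  -- empty side is a smallest part.
  · refine ⟨M.card - M.card / (k + 1), ?_, Nat.sub_le _ _, ?_⟩
    · have h1 : M.card / (k + 1) ≤ M.card - S.card := by
        refine Nat.div_le_of_le_mul ?_
        rw [Nat.add_mul]
        omega
      omega
    · refine (cliqueCountOn_le_turanCliqueCount (k + 1) (r + 1) hfree).trans ?_
      rw [turanCliqueCount.eq_add_mul, joinCliqueCount,
        Nat.sub_sub_self (Nat.div_le_self _ _)]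

end cliqueCountOn

/-! ### Lower bounds for the clique counts of the extremal graphs -/

section

open Classical Finset

variable {V : Type*} {G : SimpleGraph V}

/-- A complete multipartite graph whose part sizes differ by at most one has at least as many
cliques as the Turán graph. -/
theorem turanCliqueCount_le_cliqueCountOn (r : ℕ) {A : Finset V} {K : Finset ℕ} {c : V → ℕ}
    (hK : ∀ x ∈ A, c x ∈ K) (hadj : ∀ x ∈ A, ∀ y ∈ A, c x ≠ c y → G.Adj x y)
    (hbal : ∀ i ∈ K, ∀ j ∈ K,
      (A.filter fun x => c x = i).card ≤ (A.filter fun x => c x = j).card + 1) :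
    turanCliqueCount K.card r A.card ≤ cliqueCountOn G r A := by
  induction r generalizing A K with
  | zero => simp
  | succ r ihr =>
  obtain ⟨m, hm⟩ : ∃ m, A.card = m := ⟨_, rfl⟩
  induction m generalizing A with
  | zero => simp [hm]
  | succ m ihm =>
    obtain ⟨x, hx⟩ := card_pos.1 (by omega : 0 < A.card)
    -- Deleting a vertex `v` of a largest part keeps the partition balanced; the other parts, also
    -- balanced, lie in the neighbourhood of `v`.
    obtain ⟨i, hi, hmax⟩ := exists_max_image K (fun i => (A.filter fun x => c x = i).card)
      ⟨c x, hK x hx⟩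
    obtain ⟨v, hv⟩ : (A.filter fun x => c x = i).Nonempty := by
      rw [← card_pos]
      refine lt_of_lt_of_le (card_pos.2 ⟨x, ?_⟩) (hmax (c x) (hK x hx))
      simp [hx]
    obtain ⟨hvA, hvi⟩ := mem_filter.1 hv
    have hKc := card_erase_add_one hi
    set N := A.filter fun x => c x ≠ i with hN
    have hNsub : N ⊆ (A.erase v).filter (G.Adj v) := by
      intro y hy
      obtain ⟨hyA, hyi⟩ := mem_filter.1 hy
      have hne : c v ≠ c y := by rw [hvi]; exact fun h => hyi h.symm
      exact mem_filter.2 ⟨mem_erase.2 ⟨fun h => hne (by rw [h]), hyA⟩, hadj v hvA y hyA hne⟩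
    have hNfib : ∀ j ∈ K.erase i, N.filter (fun x => c x = j) = A.filter fun x => c x = j := by
      intro j hj
      rw [hN, filter_filter]
      refine filter_congr fun y _ => ⟨fun h => h.2, fun h => ⟨?_, h⟩⟩
      rw [h]
      exact ne_of_mem_erase hj
    have h2 := ihr (A := N) (K := K.erase i)
      (fun y hy => mem_erase.2 ⟨(mem_filter.1 hy).2, hK y (mem_filter.1 hy).1⟩)
      (fun y hy z hz => hadj y (mem_filter.1 hy).1 z (mem_filter.1 hz).1)
      (fun j hj l hl => by
        rw [hNfib j hj, hNfib l hl]
        exact hbal j (mem_of_mem_erase hj) l (mem_of_mem_erase hl))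
    have hfib : ∀ j, ((A.erase v).filter fun x => c x = j).card =
        (A.filter fun x => c x = j).card - if j = i then 1 else 0 := by
      intro j
      rw [filter_erase]
      split_ifs with h
      · rw [card_erase_of_mem (by simp [hvA, hvi, h])]
      · rw [erase_eq_of_notMem (by simp [hvA, hvi, Ne.symm h])]; rfl
    have h1 := ihm (A := A.erase v) (fun y hy => hK y (mem_of_mem_erase hy))
      (fun y hy z hz => hadj y (mem_of_mem_erase hy) z (mem_of_mem_erase hz))
      (fun j hj l hl => by
        rw [hfib j, hfib l]
        have e1 := hbal j hj l hl
        have e2 := hmax j hj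
        have e3 := hbal j hj i hi
        by_cases hji : j = i <;> by_cases hli : l = i <;> simp only [hji, hli, if_true, if_false]
        · subst hji; omega
        · subst hji; omega
        · subst hli; omega
        · omega)
      (by rw [card_erase_of_mem hvA, hm]; rfl)
    have hsum := card_eq_sum_card_fiberwise (s := A) (t := K) (f := c) (fun x hx => hK x hx)
    rw [← add_sum_erase _ _ hi] at hsum
    have hge : (K.erase i).card * ((A.filter fun x => c x = i).card - 1) ≤
        ∑ j ∈ K.erase i, (A.filter fun x => c x = j).card := by
      rw [← smul_eq_mul]
      refine card_nsmul_le_sum _ _ _ fun j hj => ?_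
      have := hbal i hi j (mem_of_mem_erase hj)
      omega
    have hpos : 0 < (A.filter fun x => c x = i).card := card_pos.2 ⟨v, hv⟩
    set f := (A.filter fun x => c x = i).card with hf
    have hNcard : f + N.card = A.card := by
      rw [hf, hN, ← card_filter_add_card_filter_not (s := A) (fun x => c x = i)]
    -- Every other part has at least `f - 1` vertices, so `m + 1 ≥ f + (|K| - 1)(f - 1)`.
    have hdiv : f - 1 ≤ m / K.card := by
      rw [Nat.le_div_iff_mul_le (by omega), ← hKc, mul_comm, Nat.add_mul]
      omega
    have hNle : m - m / K.card ≤ N.card := by omega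
    have e : cliqueCountOn G (r + 1) A =
        cliqueCountOn G (r + 1) (A.erase v) + cliqueCountOn G r ((A.erase v).filter (G.Adj v)) := by
      conv_lhs => rw [← insert_erase hvA]
      exact cliqueCountOn_insert r (notMem_erase v A)
    rw [card_erase_of_mem hvA, hm, Nat.add_sub_cancel, ← hKc] at h1
    rw [e, hm, ← hKc, turanCliqueCount.succ, hKc]
    rw [hKc] at h1
    have h3 := turanCliqueCount.mono (K.erase i).card r hNle
    have h4 := cliqueCountOn_mono (G := G) r hNsub
    omega

/-- A copy of `K_r` is determined by its vertex set. -/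
lemma copyCount_completeGraph [Fintype V] (r : ℕ) :
    G.copyCount (SimpleGraph.completeGraph (Fin r)) = cliqueCountOn G r univ := by
  have hadj : ∀ G' : G.Subgraph, Nonempty (SimpleGraph.completeGraph (Fin r) ≃g G'.coe) →
      ∀ v ∈ G'.verts, ∀ w ∈ G'.verts, v ≠ w → G'.Adj v w := by
    rintro G' ⟨e⟩ v hv w hw hvw
    have : G'.coe.Adj ⟨v, hv⟩ ⟨w, hw⟩ := by
      rw [← e.symm.map_adj_iff]
      simpa [SimpleGraph.completeGraph] using hvw
    exact this
  unfold SimpleGraph.copyCount cliqueCountOn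
  refine card_bij (fun G' _ => G'.verts.toFinset) ?_ ?_ ?_
  · intro G' hG'
    have hG := (mem_filter.1 hG').2
    refine mem_filter_isClique.2 ⟨subset_univ _, ?_, ?_⟩
    · obtain ⟨e⟩ := hG
      rw [Set.toFinset_card, ← Fintype.card_congr e.toEquiv, Fintype.card_fin]
    · intro v hv w hw hvw
      exact (hadj G' hG v (by simpa using hv) w (by simpa using hw) hvw).adj_sub
  · intro G₁ h₁ G₂ h₂ h
    have h₁ := hadj G₁ (mem_filter.1 h₁).2
    have h₂ := hadj G₂ (mem_filter.1 h₂).2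
    have hv : G₁.verts = G₂.verts := Set.toFinset_inj.1 h
    refine SimpleGraph.Subgraph.ext hv ?_
    ext v w
    exact ⟨fun h => h₂ v (hv ▸ h.fst_mem) w (hv ▸ h.snd_mem) h.ne,
      fun h => h₁ v (hv ▸ h.fst_mem) w (hv ▸ h.snd_mem) h.ne⟩
  · intro t ht
    obtain ⟨-, hc, hcl⟩ := mem_filter_isClique.1 ht
    refine ⟨(⊤ : G.Subgraph).induce t, mem_filter.2 ⟨mem_univ _, ?_⟩, by simp⟩
    have e : Fin r ≃ ((⊤ : G.Subgraph).induce (t : Set V)).verts :=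
      (Fintype.equivFinOfCardEq (by simpa using hc)).symm
    refine ⟨⟨e, ?_⟩⟩
    intro a b
    have hinj : (e a : V) = e b ↔ a = b := by rw [Subtype.coe_inj, e.apply_eq_iff_eq]
    have ha : (e a : V) ∈ t := (e a).2
    have hb : (e b : V) ∈ t := (e b).2
    simp only [SimpleGraph.Subgraph.coe_adj, SimpleGraph.Subgraph.induce_adj,
      SimpleGraph.Subgraph.top_adj, SimpleGraph.completeGraph, SimpleGraph.top_adj]
    constructor
    · exact fun h hab => h.2.2.ne (hinj.2 hab)
    · exact fun h => ⟨ha, hb, hcl ha hb (fun h' => h (hinj.1 h'))⟩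

lemma card_fin_mod_le (s k : ℕ) (hk : 0 < k) {i j : ℕ} (hi : i < k) (hj : j < k) :
    (univ.filter fun v : Fin s => v.val % k = i).card ≤
      (univ.filter fun v : Fin s => v.val % k = j).card + 1 := by
  have key : ∀ i < k, (univ.filter fun v : Fin s => v.val % k = i).card =
      s / k + if i % k < s % k then 1 else 0 := by
    intro i hi
    rw [← Nat.count_modEq_card s hk i, Nat.count_eq_card_filter_range, card_filter, card_filter,
      Fin.sum_univ_eq_sum_range (fun v => if v % k = i then 1 else 0) s]
    simp only [Nat.ModEq, Nat.mod_eq_of_lt hi]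
  rw [key i hi, key j hj]
  split_ifs <;> omega

theorem turanCliqueCount_le_turanGraph (k r m : ℕ) (hk : 0 < k) :
    turanCliqueCount k r m ≤ cliqueCountOn (SimpleGraph.turanGraph m k) r univ := by
  have := turanCliqueCount_le_cliqueCountOn (G := SimpleGraph.turanGraph m k) r (A := univ)
    (K := range k) (c := fun v => v.val % k) (fun x _ => mem_range.2 (Nat.mod_lt _ hk))
    (fun x _ y _ h => h)
    (fun i hi j hj => card_fin_mod_le m k hk (mem_range.1 hi) (mem_range.1 hj))
  simpa using this

theorem joinCliqueCount_le_alonFranklGraph (k r n s : ℕ) (hk : 0 < k) :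
    joinCliqueCount k r n s ≤ cliqueCountOn (alonFranklGraph (k + 1) n s) (r + 1) univ := by
  set H := alonFranklGraph (k + 1) n s with hH
  set A : Finset (Fin (n - s) ⊕ Fin s) := univ.map Function.Embedding.inr with hA
  set X : Finset (Fin (n - s) ⊕ Fin s) := univ.map Function.Embedding.inl with hX
  have hcA : A.card = s := by simp [hA]
  have hcX : X.card = n - s := by simp [hX]
  have hdisj : Disjoint A X := by
    rw [disjoint_left]; simp [hA, hX]
  have bal : ∀ r, turanCliqueCount k r s ≤ cliqueCountOn H r A := by
    intro r
    have hfib : ∀ i, (A.filter fun x => Sum.elim (fun _ => 0) (fun v => v.val % k) x = i).card =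
        (univ.filter fun v : Fin s => v.val % k = i).card := by
      intro i
      rw [hA, filter_map, card_map]
      rfl
    have := turanCliqueCount_le_cliqueCountOn (G := H) r (A := A) (K := range k)
      (c := Sum.elim (fun _ => 0) (fun v => v.val % k))
      (by simp [hA, Nat.mod_lt _ hk])
      (by
        simp only [hA, mem_map, mem_univ, true_and, forall_exists_index]
        rintro _ v rfl _ w rfl h
        simpa [hH, alonFranklGraph, graphJoin, SimpleGraph.turanGraph] using h)
      (fun i hi j hj => by
        rw [hfib, hfib]; exact card_fin_mod_le s k hk (mem_range.1 hi) (mem_range.1 hj))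
    simpa [hcA] using this
  have hle := le_cliqueCountOn_union (G := H) r hdisj
  have hall : ∀ x ∈ X, A.filter (H.Adj x) = A := by
    simp only [hX, hA, mem_map, mem_univ, true_and, forall_exists_index]
    rintro _ v rfl
    refine filter_true_of_mem ?_
    simp [hH, alonFranklGraph, graphJoin]
  rw [sum_congr rfl fun x hx => by rw [hall x hx], sum_const, smul_eq_mul, hcX] at hle
  refine le_trans ?_ (hle.trans (cliqueCountOn_mono _ (subset_univ _)))
  exact Nat.add_le_add (bal _) (Nat.mul_le_mul_left _ (bal _))

lemma alonFranklGraph_cliqueFree (k n s : ℕ) (hk : 0 < k) :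
    (alonFranklGraph (k + 1) n s).CliqueFree (k + 2) := by
  have C : (alonFranklGraph (k + 1) n s).Coloring (Fin (k + 1)) :=
    SimpleGraph.Coloring.mk (Sum.elim (fun _ => Fin.last k)
      (fun v => ⟨v.val % k, (Nat.mod_lt _ hk).trans (Nat.lt_succ_self k)⟩)) (by
        have hlt : ∀ v : ℕ, v % k ≠ k := fun v => (Nat.mod_lt v hk).ne
        have hlt' : ∀ v : ℕ, k ≠ v % k := fun v => (Nat.mod_lt v hk).ne'
        rintro (v | v) (w | w) h
        · simp [alonFranklGraph, graphJoin] at h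
        · simp [Fin.ext_iff, hlt']
        · simp [Fin.ext_iff, hlt]
        · simpa [alonFranklGraph, graphJoin, SimpleGraph.turanGraph] using h)
  exact C.colorable.cliqueFree (by simp)

/-- The join is realised by a `(k + 1)`-colourable graph, to which Zykov's theorem applies. This
supplies the hypothesis `hT` of `joinCliqueCount_add_mul_le`. -/
lemma joinCliqueCount_le_turanCliqueCount (k r m u : ℕ) (hk : 0 < k) (hu : u ≤ m) :
    joinCliqueCount k r m u ≤ turanCliqueCount (k + 1) (r + 1) m := by
  refine (joinCliqueCount_le_alonFranklGraph k r m u hk).trans ?_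
  have := cliqueCountOn_le_turanCliqueCount (G := alonFranklGraph (k + 1) m u) (k + 1) (r + 1)
    (A := univ) (alonFranklGraph_cliqueFree k m u hk).cliqueFreeOn
  simpa [Nat.sub_add_cancel hu] using this

end

/-! ### Matchings and the Tutte–Berge formula -/

section

open Classical Finset

variable {V : Type*} {G : SimpleGraph V}

/-- The pairs `{v, m v}` are disjoint edges; an ordering of `V` selects one end of each, so at least
half of `A` is needed for the ends. -/
lemma matchingGraph_isContained_of_involution [Fintype V] {t : ℕ} {A : Finset V} (m : V → V)
    (hmA : ∀ v ∈ A, m v ∈ A) (hmm : ∀ v ∈ A, m (m v) = v) (hadj : ∀ v ∈ A, G.Adj v (m v))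
    (ht : 2 * t ≤ A.card) : (matchingGraph t).IsContained G := by
  let e := Fintype.equivFin V
  set A₀ := A.filter fun v => e v < e (m v) with hA₀
  have hcard : A.card ≤ 2 * A₀.card := by
    have hsub : A ⊆ A₀ ∪ A₀.image m := by
      intro v hv
      rcases lt_or_gt_of_ne (e.injective.ne (hadj v hv).ne) with h | h
      · exact mem_union_left _ (mem_filter.2 ⟨hv, h⟩)
      · refine mem_union_right _ (mem_image.2 ⟨m v, mem_filter.2 ⟨hmA v hv, ?_⟩, hmm v hv⟩)
        rwa [hmm v hv]
    have h1 := card_le_card hsub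
    have h2 := card_union_le A₀ (A₀.image m)
    have h3 := card_image_le (s := A₀) (f := m)
    omega
  obtain ⟨p⟩ : Nonempty (Fin t ↪ A₀) :=
    Function.Embedding.nonempty_of_card_le (by
      simp only [Fintype.card_fin, Fintype.card_coe]; omega)
  have hpA : ∀ i, (p i : V) ∈ A := fun i => (mem_filter.1 (p i).2).1
  have hplt : ∀ i, e (p i : V) < e (m (p i)) := fun i => (mem_filter.1 (p i).2).2
  have hpinj : ∀ i j, (p i : V) = p j → i = j := fun i j h => p.injective (Subtype.ext h)
  have hne : ∀ i j, (p i : V) ≠ m (p j) := by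
    intro i j h
    have h1 := hplt i
    rw [h, hmm _ (hpA j)] at h1
    exact lt_asymm h1 (hplt j)
  let idx : Fin (2 * t) → Fin t := fun x => ⟨x.val / 2, by omega⟩
  let φ : Fin (2 * t) → V := fun x => if x.val % 2 = 0 then (p (idx x) : V) else m (p (idx x))
  have hφ : ∀ x y, φ x = φ y → x.val % 2 = y.val % 2 ∧ idx x = idx y := by
    intro x y h
    simp only [φ] at h
    split_ifs at h with hx hy hy
    · exact ⟨by omega, hpinj _ _ h⟩
    · exact (hne _ _ h).elim
    · exact (hne _ _ h.symm).elim
    · refine ⟨by omega, hpinj _ _ ?_⟩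
      rw [← hmm _ (hpA (idx x)), h, hmm _ (hpA (idx y))]
  refine ⟨⟨⟨φ, ?_⟩, ?_⟩⟩
  · rintro x y ⟨hxy, hdiv⟩
    have hval : x.val ≠ y.val := fun h => hxy (Fin.ext h)
    have hidx : idx x = idx y := Fin.ext hdiv
    simp only [φ, hidx]
    split_ifs with hx hy hy
    · omega
    · exact hadj _ (hpA _)
    · exact (hadj _ (hpA _)).symm
    · omega
  · intro x y h
    obtain ⟨h1, h2⟩ := hφ x y h
    have h3 : x.val / 2 = y.val / 2 := congrArg Fin.val h2
    exact Fin.ext (by omega)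

/-- At most `d` vertices of `V` are matched into the added clique, so at least `2 * t` are matched
among themselves. -/
lemma matchingGraph_isContained_of_isPerfectMatching [Fintype V] {t d : ℕ}
    (hd : 2 * t + d ≤ Fintype.card V) {M : (graphJoin G (⊤ : SimpleGraph (Fin d))).Subgraph}
    (hM : M.IsPerfectMatching) : (matchingGraph t).IsContained G := by
  choose m' hm' huniq using fun x => hM.1 (hM.2 x)
  have hinv : ∀ x, m' (m' x) = x := fun x => (huniq _ x (hm' x).symm).symm
  let m : V → V := fun v => Sum.elim id (fun _ => v) (m' (Sum.inl v))
  set A : Finset V := univ.filter fun v => ∃ w, m' (Sum.inl v) = Sum.inl w with hA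
  have hmA : ∀ v ∈ A, m' (Sum.inl v) = Sum.inl (m v) := by
    intro v hv
    obtain ⟨w, hw⟩ := (mem_filter.1 hv).2
    simp [m, hw]
  have hmm : ∀ v ∈ A, m' (Sum.inl (m v)) = Sum.inl v := by
    intro v hv
    rw [← hmA v hv, hinv]
  have hmem : ∀ v ∈ A, m v ∈ A := fun v hv => mem_filter.2 ⟨mem_univ _, v, hmm v hv⟩
  refine matchingGraph_isContained_of_involution (A := A) m hmem ?_ ?_ ?_
  · intro v hv
    have := hmA (m v) (hmem v hv)
    rw [hmm v hv] at this
    exact (Sum.inl_injective this).symm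
  · intro v hv
    have := (hm' (Sum.inl v)).adj_sub
    rw [hmA v hv] at this
    simpa [graphJoin] using this
  · have h1 : (univ.filter fun v => ¬ ∃ w, m' (Sum.inl v) = Sum.inl w).card ≤ d := by
      have : ((univ : Finset (Fin d)).map
          (Function.Embedding.inr : Fin d ↪ V ⊕ Fin d)).card = d := by simp
      refine le_trans (card_le_card_of_injOn (fun v => m' (Sum.inl v)) ?_ ?_) this.le
      · intro v hv
        have hv := (mem_filter.1 (mem_coe.1 hv)).2
        rcases h : m' (Sum.inl v) with w | w
        · exact (hv ⟨w, h⟩).elim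
        · simp [h]
      · intro v _ w _ h
        dsimp only at h
        have := hinv (Sum.inl v)
        rw [h, hinv] at this
        exact (Sum.inl_injective this).symm
    have h2 := card_filter_add_card_filter_not (s := (univ : Finset V))
      (fun v => ∃ w, m' (Sum.inl v) = Sum.inl w)
    rw [card_univ, ← hA] at h2
    omega

end

section

universe u

open Classical Finset

variable {V : Type u} {G : SimpleGraph V}

/-- The hard direction of the **Tutte–Berge formula**: if `G` has no matching with `s + 1` edges,
then deleting some set `B` leaves at least `n + |B| - 2s` components. -/
theorem exists_labelling_of_matchingGraph_free [Fintype V] {s : ℕ}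
    (hs : 2 * s + 2 ≤ Fintype.card V) (hfree : (matchingGraph (s + 1)).Free G) :
    ∃ (ι : Type u) (B : Finset V) (κ : V → ι),
      (∀ v ∉ B, ∀ w ∉ B, G.Adj v w → κ v = κ w) ∧
      Fintype.card V + B.card ≤ 2 * s + (Bᶜ.image κ).card := by
  obtain ⟨d, hd⟩ : ∃ d, Fintype.card V = 2 * (s + 1) + d := ⟨_, by
    rw [Nat.mul_succ]; exact (Nat.add_sub_cancel' hs).symm⟩
  -- A perfect matching of `G ∨ K_d` would leave `s + 1` edges inside `G`, so Tutte's condition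
  -- fails for `G'`.
  set G' := graphJoin G (⊤ : SimpleGraph (Fin d)) with hG'
  obtain ⟨u, hu⟩ : ∃ u, G'.IsTutteViolator u := by
    by_contra! h
    obtain ⟨M, hM⟩ := SimpleGraph.tutte.2 h
    exact hfree (matchingGraph_isContained_of_isPerfectMatching hd.ge hM)
  set H := ((⊤ : G'.Subgraph).deleteVerts u).coe with hH
  have hverts : ∀ x, x ∈ ((⊤ : G'.Subgraph).deleteVerts u).verts ↔ x ∉ u := by simp
  have hHadj : ∀ x y, H.Adj x y ↔ G'.Adj x y := by
    intro x y
    have hx := (hverts x).1 x.2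
    have hy := (hverts y).1 y.2
    simp [hH, hx, hy]
  have hparity := H.odd_ncard_oddComponents
  have hcard : Nat.card ((⊤ : G'.Subgraph).deleteVerts u).verts + u.ncard =
      2 * (s + 1) + d + d := by
    have h1 := Set.ncard_add_ncard_compl u
    have h2 : ((⊤ : G'.Subgraph).deleteVerts u).verts = uᶜ := by ext x; simp
    rw [h2, Nat.card_coe_set_eq, add_comm, h1, Nat.card_eq_fintype_card, Fintype.card_sum,
      Fintype.card_fin, hd]
  unfold SimpleGraph.IsTutteViolator at hu
  rw [← hH] at hu
  -- `G'` has even order, so the number of odd components has the parity of `|u|` and cannot exceed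
  -- it by exactly one.
  have hodd : u.ncard + 2 ≤ H.oddComponents.ncard := by
    by_contra hlt
    have h1 : H.oddComponents.ncard = u.ncard + 1 := by omega
    rw [h1, Nat.odd_iff, Nat.odd_iff] at hparity
    omega
  -- A vertex of `K_d` outside `u` would be adjacent to all other remaining vertices, leaving a
  -- single component; at least two are odd.
  have hinr : ∀ w, Sum.inr w ∈ u := by
    intro w
    by_contra hw
    have hall : ∀ x, H.connectedComponentMk x =
        H.connectedComponentMk ⟨Sum.inr w, (hverts _).2 hw⟩ := by
      intro x
      rw [SimpleGraph.ConnectedComponent.eq]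
      by_cases hx : x = ⟨Sum.inr w, (hverts _).2 hw⟩
      · rw [hx]
      · refine SimpleGraph.Adj.reachable ((hHadj _ _).2 ?_)
        obtain ⟨x | x, hx'⟩ := x
        · simp [hG', graphJoin]
        · simpa [hG', graphJoin] using hx
    have : H.oddComponents.ncard ≤ 1 := by
      rw [Set.ncard_le_one_iff]
      intro a b _ _
      induction a using SimpleGraph.ConnectedComponent.ind with | _ a
      induction b using SimpleGraph.ConnectedComponent.ind with | _ b
      rw [hall a, hall b]
    omega
  let B : Finset V := univ.filter fun v => Sum.inl v ∈ u
  have hB : ∀ v, v ∉ B ↔ Sum.inl v ∉ u := by simp [B]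
  let κ : V → Option H.ConnectedComponent := fun v =>
    if h : Sum.inl v ∈ u then none else some (H.connectedComponentMk ⟨Sum.inl v, (hverts _).2 h⟩)
  refine ⟨_, B, κ, ?_, ?_⟩
  · intro v hv w hw hvw
    rw [hB] at hv hw
    simp only [κ, dif_neg hv, dif_neg hw, Option.some_inj, SimpleGraph.ConnectedComponent.eq]
    refine SimpleGraph.Adj.reachable ((hHadj _ _).2 ?_)
    simpa [hG', graphJoin] using hvw
  · have h1 : B.card + d ≤ u.ncard := by
      have : (B.disjSum (univ : Finset (Fin d))).card = B.card + d := by simp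
      rw [← this, ← Set.ncard_coe_finset]
      refine Set.ncard_le_ncard ?_ (Set.toFinite _)
      rintro (x | x) hx
      · simpa [B] using hx
      · exact hinr x
    have h2 : H.oddComponents.ncard ≤ (Bᶜ.image κ).card := by
      rw [← Set.ncard_image_of_injective _ (Option.some_injective _), ← Set.ncard_coe_finset]
      refine Set.ncard_le_ncard ?_ (Set.toFinite _)
      rintro _ ⟨c, -, rfl⟩
      induction c using SimpleGraph.ConnectedComponent.ind with
      | _ x =>
      obtain ⟨x | x, hx⟩ := x
      · have hx' := (hverts _).1 hx
        refine mem_coe.2 (mem_image.2 ⟨x, mem_compl.2 ((hB x).2 hx'), ?_⟩)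
        simp [κ, hx']
      · exact ((hverts _).1 hx (hinr x)).elim
    convert (show Fintype.card V + B.card ≤ 2 * s + (Bᶜ.image κ).card by omega)

end

/-! ### Symmetrisation and the upper bound -/

section

open Classical Finset

variable {V : Type*} {G G' : SimpleGraph V}

lemma cliqueCountOn_congr (r : ℕ) {A : Finset V}
    (h : ∀ x ∈ A, ∀ y ∈ A, (G.Adj x y ↔ G'.Adj x y)) :
    cliqueCountOn G r A = cliqueCountOn G' r A := by
  unfold cliqueCountOn
  congr 1
  refine filter_congr fun t ht => ?_
  have ht := (mem_powersetCard.1 ht).1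
  exact ⟨fun hc x hx y hy hxy => (h x (ht hx) y (ht hy)).1 (hc hx hy hxy),
    fun hc x hx y hy hxy => (h x (ht hx) y (ht hy)).2 (hc hx hy hxy)⟩

/-- Adjacent vertices have distinct images, as `G` has no loops, so cliques map injectively. -/
lemma cliqueFree_comap {W : Type*} (f : W → V) {m : ℕ} (h : G.CliqueFree m) :
    (G.comap f).CliqueFree m := by
  rw [SimpleGraph.cliqueFree_iff] at h ⊢
  refine ⟨fun φ => h.elim ?_⟩
  let ψ : SimpleGraph.completeGraph (Fin m) →g G :=
    ⟨fun x => f (φ x), fun hab => φ.toHom.map_adj hab⟩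
  exact ⟨ψ, SimpleGraph.Hom.injective_of_top_hom ψ⟩

/-- Replacing the vertices of `X` by twins of a vertex `y` lying in at least as many cliques as each
of them does not decrease the number of cliques. -/
lemma cliqueCountOn_le_comap [Fintype V] (r : ℕ) {X : Finset V} {y : V}
    (hyX : ∀ x ∈ X, ¬ G.Adj y x)
    (hmax : ∀ x ∈ X, cliqueCountOn G r (univ.filter (G.Adj x)) ≤
      cliqueCountOn G r (univ.filter (G.Adj y))) :
    cliqueCountOn G (r + 1) univ ≤
      cliqueCountOn (G.comap fun v => if v ∈ X then y else v) (r + 1) univ := by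
  set G' := G.comap fun v => if v ∈ X then y else v with hG'
  have hu : Xᶜ ∪ X = univ := by rw [union_comm]; exact union_compl X
  have hcongr : ∀ {A : Finset V} r, A ⊆ Xᶜ → cliqueCountOn G r A = cliqueCountOn G' r A := by
    intro A r hA
    refine cliqueCountOn_congr r fun a ha b hb => ?_
    simp [hG', mem_compl.1 (hA ha), mem_compl.1 (hA hb)]
  -- In `G` the sum over `X` may overcount cliques with several vertices in `X`; in `G'` it counts
  -- cliques with exactly one, which suffices for the lower bound.
  have h1 := cliqueCountOn_union_le (G := G) r Xᶜ X
  have h2 := le_cliqueCountOn_union (G := G') r (disjoint_compl_left (a := X))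
  rw [hu] at h1 h2
  refine h1.trans (le_trans (Nat.add_le_add (hcongr _ Subset.rfl).le (sum_le_sum ?_)) h2)
  intro x hx
  refine (hmax x hx).trans ?_
  have hsub : univ.filter (G.Adj y) ⊆ Xᶜ := fun z hz =>
    mem_compl.2 fun hzX => hyX z hzX (mem_filter.1 hz).2
  rw [hcongr r hsub]
  refine cliqueCountOn_mono r fun z hz => mem_filter.2 ⟨hsub hz, ?_⟩
  simpa [hG', hx, mem_compl.1 (hsub hz)] using (mem_filter.1 hz).2

/-- The upper bound on the number of cliques in a `K_{k+3}`-free graph without a matching of size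
`s + 1`. -/
theorem cliqueCountOn_univ_le_max [Fintype V] {s k r : ℕ}
    (hn : 2 * s + 1 ≤ Fintype.card V) (hK : G.CliqueFree (k + 3))
    (hM : (matchingGraph (s + 1)).Free G) :
    cliqueCountOn G (r + 2) univ ≤ max (turanCliqueCount (k + 2) (r + 2) (2 * s + 1))
      (joinCliqueCount (k + 1) (r + 1) (Fintype.card V) s) := by
  rcases hn.eq_or_lt with heq | hlt
  · refine le_max_of_le_left ?_
    rw [heq, ← card_univ]
    exact cliqueCountOn_le_turanCliqueCount _ _ hK.cliqueFreeOn
  obtain ⟨ι, B, κ, hκ, hcard⟩ := exists_labelling_of_matchingGraph_free hlt hM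
  set n := Fintype.card V with hnV
  have hBc : Bᶜ.card = n - B.card := card_compl B
  have hBn : B.card ≤ n := card_le_univ B
  have hple : (Bᶜ.image κ).card ≤ Bᶜ.card := card_image_le
  obtain ⟨y, hyB, hymax⟩ := exists_max_image Bᶜ
    (fun v => cliqueCountOn G (r + 1) (univ.filter (G.Adj v))) (card_pos.1 (by omega))
  have hLcard := card_erase_of_mem (mem_image_of_mem κ hyB)
  -- There are at least `n + |B| - 2s` labels; setting aside that of `y` accounts for `2s + 1`.
  obtain ⟨T, hTL, hTcard⟩ := exists_subset_card_eq
    (show n + B.card - (2 * s + 1) ≤ ((Bᶜ.image κ).erase (κ y)).card by omega)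
  have hrep : ∀ l : T, ∃ v ∈ Bᶜ, κ v = l := fun l =>
    mem_image.1 (mem_of_mem_erase (hTL l.2))
  choose ρ hρB hρκ using hrep
  have hρinj : Function.Injective ρ := fun a b h => Subtype.ext (by rw [← hρκ a, h, hρκ b])
  set I : Finset V := univ.image ρ with hI
  have hIcard : I.card = n + B.card - (2 * s + 1) := by
    rw [hI, card_image_of_injective _ hρinj, card_univ, Fintype.card_coe, hTcard]
  have hIB : ∀ z ∈ I, z ∉ B := by
    intro z hz
    obtain ⟨l, -, rfl⟩ := mem_image.1 hz
    exact mem_compl.1 (hρB l)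
  have hIy : ∀ z ∈ I, κ z ≠ κ y := by
    intro z hz
    obtain ⟨l, -, rfl⟩ := mem_image.1 hz
    rw [hρκ]
    exact ne_of_mem_erase (hTL l.2)
  have hIinj : ∀ z ∈ I, ∀ w ∈ I, κ z = κ w → z = w := by
    intro z hz w hw h
    obtain ⟨l, -, rfl⟩ := mem_image.1 hz
    obtain ⟨l', -, rfl⟩ := mem_image.1 hw
    rw [hρκ, hρκ] at h
    rw [Subtype.ext h]
  have hyB' := mem_compl.1 hyB
  set X : Finset V := (Bᶜ.filter fun v => κ v ≠ κ y) \ I with hX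
  have hXmem : ∀ v, v ∈ X ↔ (v ∉ B ∧ κ v ≠ κ y) ∧ v ∉ I := by simp [hX]
  refine (cliqueCountOn_le_comap (r + 1) (X := X) (y := y) ?_ ?_).trans ?_
  · intro x hx hadj
    obtain ⟨⟨h1, h2⟩, -⟩ := (hXmem x).1 hx
    exact h2 (hκ y hyB' x h1 hadj).symm
  · exact fun x hx => hymax x (mem_compl.2 ((hXmem x).1 hx).1.1)
  set G' := G.comap fun v => if v ∈ X then y else v with hG'
  have hK' : G'.CliqueFree (k + 3) := cliqueFree_comap _ hK
  have hIX : ∀ z ∈ I, z ∉ X := fun z hz hzX => ((hXmem z).1 hzX).2 hz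
  -- Outside `B`, a neighbour of `z` in `G'` cannot be a twin of `y`, whose label differs from that
  -- of `z`; any other vertex with the label of `z` would have been put into `X`.
  have hIN : ∀ z ∈ I, univ.filter (G'.Adj z) ⊆ B := by
    intro z hz w hw
    by_contra hwB
    have hadj : G.Adj z (if w ∈ X then y else w) := by
      simpa [hG', hIX z hz] using (mem_filter.1 hw).2
    split_ifs at hadj with hwX
    · exact hIy z hz (hκ z (hIB z hz) y hyB' hadj)
    · have hzw := hκ z (hIB z hz) w hwB hadj
      by_cases hwI : w ∈ I
      · exact hadj.ne (hIinj z hz w hwI hzw)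
      · exact hwX ((hXmem w).2 ⟨⟨hwB, fun h => hIy z hz (hzw.trans h)⟩, hwI⟩)
  obtain ⟨z, hz, hzmax⟩ := exists_max_image I
    (fun v => cliqueCountOn G' (r + 1) (univ.filter (G'.Adj v))) (card_pos.1 (by omega))
  set S := univ.filter (G'.Adj z) with hS
  have hSB : S ⊆ B := hIN z hz
  have hSM : S ⊆ Iᶜ := fun x hx => mem_compl.2 fun hxI => hIB x hxI (hSB hx)
  have hSfree : G'.CliqueFreeOn (S : Set V) (k + 2) :=
    cliqueFreeOn_filter_adj hK'.cliqueFreeOn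
  obtain ⟨u, hSu, huM, hu⟩ := exists_cliqueCountOn_le_joinCliqueCount (k + 1) (r + 1) hSM hSfree
    hK'.cliqueFreeOn
  have hMcard : Iᶜ.card = 2 * s + 1 - B.card := by
    rw [card_compl, ← hnV]
    omega
  rw [hMcard] at huM hu
  have hdeg : cliqueCountOn G' (r + 1) S ≤ turanCliqueCount (k + 1) (r + 1) (min u B.card) :=
    (cliqueCountOn_le_turanCliqueCount _ _ hSfree).trans
      (turanCliqueCount.mono _ _ (le_min hSu (card_le_card hSB)))
  have hsplit := cliqueCountOn_union_le (G := G') (r + 1) Iᶜ I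
  rw [union_comm, union_compl] at hsplit
  have hsum := sum_le_card_nsmul I
    (fun v => cliqueCountOn G' (r + 1) (univ.filter (G'.Adj v))) _
    (fun v hv => (hzmax v hv).trans hdeg)
  rw [smul_eq_mul, show I.card = n - (2 * s + 1 - B.card) by omega] at hsum
  exact (hsplit.trans (Nat.add_le_add hu hsum)).trans
    (joinCliqueCount_add_mul_le hn (by omega) huM
      fun u hu => joinCliqueCount_le_turanCliqueCount (k + 1) (r + 1) _ u (Nat.succ_pos k) hu)

lemma matchingGraph_adj_iff {t : ℕ} {v w : Fin (2 * t)} :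
    (matchingGraph t).Adj v w ↔ v ≠ w ∧ v.val / 2 = w.val / 2 := Iff.rfl

/-- A matching has no isolated vertices, so a copy would place `2s + 2` vertices in `C`. -/
lemma matchingGraph_free_of_support {s : ℕ} {C : Finset V} (hC : C.card ≤ 2 * s + 1)
    (h : ∀ v w, G.Adj v w → v ∈ C) : (matchingGraph (s + 1)).Free G := by
  rintro ⟨φ⟩
  have hmem : ∀ x, φ x ∈ C := by
    intro x
    have hx := x.2
    refine h _ (φ ⟨if x.val % 2 = 0 then x.val + 1 else x.val - 1, by split_ifs <;> omega⟩)
      (φ.toHom.map_adj (matchingGraph_adj_iff.2 ⟨?_, ?_⟩))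
    · rw [Ne, Fin.ext_iff]; dsimp only; split_ifs <;> omega
    · dsimp only; split_ifs <;> omega
  have := card_le_card_of_injOn (s := univ) (t := C) φ (fun x _ => hmem x) φ.injective.injOn
  rw [card_univ, Fintype.card_fin] at this
  omega

/-- Each of the `s + 1` disjoint edges would need its own vertex of `C`. -/
lemma matchingGraph_free_of_cover {s : ℕ} {C : Finset V} (hC : C.card ≤ s)
    (h : ∀ v w, G.Adj v w → v ∈ C ∨ w ∈ C) : (matchingGraph (s + 1)).Free G := by
  rintro ⟨φ⟩
  have hex : ∀ i : Fin (s + 1), ∃ x : Fin (2 * (s + 1)), x.val / 2 = i.val ∧ φ x ∈ C := by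
    intro i
    have hi := i.2
    rcases h (φ ⟨2 * i.val, by omega⟩) (φ ⟨2 * i.val + 1, by omega⟩)
      (φ.toHom.map_adj (matchingGraph_adj_iff.2 ⟨by simp [Fin.ext_iff], by dsimp only; omega⟩))
      with hc | hc
    · exact ⟨_, by dsimp only; omega, hc⟩
    · exact ⟨_, by dsimp only; omega, hc⟩
  choose x hx hxC using hex
  have := card_le_card_of_injOn (s := univ) (t := C) (fun i => φ (x i)) (fun i _ => hxC i)
    (fun i _ j _ hij => Fin.ext (by rw [← hx i, ← hx j, φ.injective hij]))
  rw [card_univ, Fintype.card_fin] at this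
  omega

end

/-! ### Transfer to `Fin n` and the final theorem -/

section

open Classical Finset

/-- Vertices outside the range of `f` are isolated, hence in no clique of size `r > 1`. -/
lemma cliqueCountOn_map {V W : Type*} [Fintype V] [Fintype W] (G : SimpleGraph V) (f : V ↪ W)
    {r : ℕ} (hr : 1 < r) :
    cliqueCountOn (G.map f) r univ = cliqueCountOn G r univ := by
  unfold cliqueCountOn
  rw [← card_map ⟨Finset.map f, Finset.map_injective f⟩]
  congr 1
  ext t
  simp only [mem_filter_isClique, mem_map, Function.Embedding.coeFn_mk, subset_univ, true_and]
  have := SimpleGraph.isNClique_map_iff (G := G) hr (t := t) (f := f)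
  simp only [SimpleGraph.isNClique_iff] at this
  rw [and_comm, this]
  exact exists_congr fun s => by rw [and_comm (a := G.IsClique (s : Set V))]

lemma familyFree_of_cliqueFree {n k s : ℕ} {G : SimpleGraph (Fin n)} (hK : G.CliqueFree (k + 1))
    (hM : (matchingGraph (s + 1)).Free G) :
    FamilyFree {⟨k + 1, SimpleGraph.completeGraph (Fin (k + 1))⟩,
      ⟨2 * (s + 1), matchingGraph (s + 1)⟩} G := by
  rintro H (rfl | rfl)
  · have := SimpleGraph.cliqueFree_iff_top_free (G := G) (β := Fin (k + 1))
    rw [Fintype.card_fin] at this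
    exact this.1 hK
  · exact hM

lemma cliqueFree_of_familyFree {n k : ℕ} {𝓗 : GraphFamily} {G : SimpleGraph (Fin n)}
    (h : FamilyFree (insert ⟨k, SimpleGraph.completeGraph (Fin k)⟩ 𝓗) G) :
    G.CliqueFree k := by
  have := SimpleGraph.cliqueFree_iff_top_free (G := G) (β := Fin k)
  rw [Fintype.card_fin] at this
  exact this.2 (h _ (Or.inl rfl))

end

theorem theorem1p4 (n s k r : ℕ) (hn : 2 * s + 1 ≤ n) (hr : 3 ≤ r) (hk : r ≤ k) :
    IsGeneralizedTuranNumber n (SimpleGraph.completeGraph (Fin r))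
      {⟨k + 1, SimpleGraph.completeGraph (Fin (k + 1))⟩, ⟨2 * (s + 1), matchingGraph (s + 1)⟩}
      (max ((SimpleGraph.turanGraph (2 * s + 1) k).copyCount (SimpleGraph.completeGraph (Fin r)))
        ((alonFranklGraph k n s).copyCount (SimpleGraph.completeGraph (Fin r)))) := by
  classical
  obtain ⟨k, rfl⟩ : ∃ j, k = j + 2 := ⟨k - 2, by omega⟩
  obtain ⟨r, rfl⟩ : ∃ j, r = j + 2 := ⟨r - 2, by omega⟩
  constructor
  · have hT : ∃ G : SimpleGraph (Fin n), FamilyFree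
        {⟨k + 2 + 1, SimpleGraph.completeGraph (Fin (k + 2 + 1))⟩,
          ⟨2 * (s + 1), matchingGraph (s + 1)⟩} G ∧
        (SimpleGraph.turanGraph (2 * s + 1) (k + 2)).copyCount
          (SimpleGraph.completeGraph (Fin (r + 2))) =
        G.copyCount (SimpleGraph.completeGraph (Fin (r + 2))) := by
      let f : Fin (2 * s + 1) ↪ Fin n := Fin.castLEEmb hn
      refine ⟨(SimpleGraph.turanGraph (2 * s + 1) (k + 2)).map f,
        familyFree_of_cliqueFree (k := k + 2) (s := s) ?_ ?_, ?_⟩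
      · rw [SimpleGraph.cliqueFree_map_iff]
        exact SimpleGraph.turanGraph_cliqueFree (by omega)
      · refine matchingGraph_free_of_support (C := Finset.univ.map f) (by simp) ?_
        rintro _ _ ⟨-, v, w, -, rfl, rfl⟩
        simp
      · rw [copyCount_completeGraph, copyCount_completeGraph, cliqueCountOn_map _ _ (by omega)]
    have hA : ∃ G : SimpleGraph (Fin n), FamilyFree
        {⟨k + 2 + 1, SimpleGraph.completeGraph (Fin (k + 2 + 1))⟩,
          ⟨2 * (s + 1), matchingGraph (s + 1)⟩} G ∧
        (alonFranklGraph (k + 2) n s).copyCount (SimpleGraph.completeGraph (Fin (r + 2))) =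
        G.copyCount (SimpleGraph.completeGraph (Fin (r + 2))) := by
      let e : Fin (n - s) ⊕ Fin s ≃ Fin n := finSumFinEquiv.trans (finCongr (by omega))
      have : Nonempty (Fin (n - s) ⊕ Fin s) := ⟨e.symm ⟨0, by omega⟩⟩
      refine ⟨(alonFranklGraph (k + 2) n s).map e.toEmbedding,
        familyFree_of_cliqueFree (k := k + 2) (s := s) ?_ ?_, ?_⟩
      · rw [SimpleGraph.cliqueFree_map_iff]
        exact alonFranklGraph_cliqueFree (k + 1) n s (Nat.succ_pos k)
      · refine matchingGraph_free_of_cover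
          (C := (Finset.univ.map Function.Embedding.inr).map e.toEmbedding) (by simp) ?_
        rintro _ _ ⟨-, v | v, w | w, h, rfl, rfl⟩
        · simp [alonFranklGraph, graphJoin] at h
        all_goals simp
      · rw [copyCount_completeGraph, copyCount_completeGraph, cliqueCountOn_map _ _ (by omega)]
    rcases max_choice ((SimpleGraph.turanGraph (2 * s + 1) (k + 2)).copyCount
        (SimpleGraph.completeGraph (Fin (r + 2))))
      ((alonFranklGraph (k + 2) n s).copyCount (SimpleGraph.completeGraph (Fin (r + 2))))
      with h | h <;> rw [h]
    · exact hT
    · exact hA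
  · rintro _ ⟨G, hG, rfl⟩
    rw [copyCount_completeGraph, copyCount_completeGraph, copyCount_completeGraph]
    have h := cliqueCountOn_univ_le_max (r := r) (by simpa using hn) (cliqueFree_of_familyFree hG)
      (hG ⟨2 * (s + 1), matchingGraph (s + 1)⟩ (Or.inr rfl))
    rw [Fintype.card_fin] at h
    exact h.trans (max_le_max (turanCliqueCount_le_turanGraph _ _ _ (by omega))
      (joinCliqueCount_le_alonFranklGraph (k + 1) (r + 1) n s (Nat.succ_pos k)))
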